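/- Let $\Lambda=\mathbb C[p_1,p_2,p_3,\dots]$ be the ring of symmetric functions ($p_k$ the power sums) and let the Bernstein operators $B_n$ ($n\in\mathbb Z$) on $\Lambda$ be defined by $$\sum_{n\in\mathbb Z}B_nt^n=\exp\Big(\sum_{k\ge1}\frac{t^k}{k}p_k\Big)\exp\Big(-\sum_{k\ge1}t^{-k}\frac{\partial}{\partial p_k}\Big).$$ For a finite sequence $\mu=(\mu_1,\dots,\mu_m)$ of integers write $B_\mu=B_{\mu_1}B_{\mu_2}\cdots B_{\mu_m}$. A partition is a weakly decreasing finite sequence of nonnegative integers (zero parts are allowed and counted in the length). Its code is the doubly infinite sequence of letters $R$ (unit right step) and $U$ (unit up step), taken up to a shift of positions, obtained by tracing the bottom-right edge of its Young diagram in the fourth quadrant together with the negative $y$-axis (first) and the positive $x$-axis (last). Let $\lambda=(\lambda_1,\dots,\lambda_l)$, $l\ge1$, be a partition, let $n$ be any integer with $n<\lambda_1$, and put $k=\lambda_1-n$. Then $\lambda$ has a code, and its code has a rightmost $U$. Let $\zeta$ be the letter $k-1$ positions left of this rightmost $U$. - If $\zeta=U$, then $B_nB_\lambda\cdot 1=0$.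 If moreover $n\ge -l$ (that is, $\zeta$ is the up step of one of the rows $1,\dots,l$ and does not lie on the negative $y$-axis below row $l$), then $B_nB_\lambda=0$ as an operator on $\Lambda$. - If $\zeta=R$, then there is a partition $\nu$ with $l+1$ parts whose code is obtained from the code of $\lambda$ by replacing $\zeta$ by $U$, and for this $\nu$ one has $B_nB_\lambda=(-1)^{j+1}B_\nu$ as operators on $\Lambda$, where $j$ is the number of $U$'s strictly between $\zeta$ and the rightmost $U$. -/

import Mathlib

noncomputable section

namespace BernsteinCode

/-! ## Partitions and their codes -/

/-- A partition `(λ₁, …, λ_l)`, written as a list of natural numbers, is weakly decreasing.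
Zero parts are allowed and are counted in the length `l`. -/
def IsPartition (lam : List ℕ) : Prop := lam.Pairwise (fun a b => b ≤ a)

/-- The two letters of the code of a partition. -/
inductive Letter where
  | R : Letter
  | U : Letter
  deriving DecidableEq

/-- The displacement of the step encoded by a letter: `R` is one unit right, `U` one unit up. -/
def Letter.vec : Letter → ℤ × ℤ
  | Letter.R => (1, 0)
  | Letter.U => (0, 1)

/-- The lattice point `v` lies on the bottom-right edge of the Young diagram (drawn in the fourth
quadrant, its top left corner at the origin, the part `λ_i` being the row between the heights
`-i` and `-i + 1`) together with the negative `y`-axis and the positive `x`-axis: `v = (x, -r)`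
with `λ_{r+1} ≤ x` and, unless `r = 0`, also `x ≤ λ_r`. As usual `λ_i = 0` for `i > l`;
`lam.getD r 0` is `λ_{r+1}`. -/
def OnEdge (lam : List ℕ) (v : ℤ × ℤ) : Prop :=
  ∃ r : ℕ, v.2 = -(r : ℤ) ∧ (lam.getD r 0 : ℤ) ≤ v.1 ∧
    (0 < r → v.1 ≤ (lam.getD (r - 1) 0 : ℤ))

/-- The doubly infinite word `w` is a code of `lam`: it is the sequence of letters of a doubly
infinite path of unit right and up steps that runs along the edge of the Young diagram.
A doubly infinite word has no distinguished position, so `w` is determined only up to a shift. -/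
def IsCode (lam : List ℕ) (w : ℤ → Letter) : Prop :=
  ∃ P : ℤ → ℤ × ℤ, (∀ i, OnEdge lam (P i)) ∧ ∀ i, P (i + 1) = P i + (w i).vec

/-! ## Bernstein operators -/

/-- The ring of symmetric functions `Λ = ℂ[p₁, p₂, p₃, …]`, the polynomial ring in the power
sums `p_k`, where `p_k` is the variable `MvPolynomial.X k`. -/
abbrev Sym : Type := MvPolynomial ℕ+ ℂ

/-- The coefficient of `t ^ n` in `exp g = ∑ m, g ^ m / m!`, for a power series `g` in `t`
without constant term (so that `g ^ m` contributes nothing for `m > n`). -/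
def expCoeff {A : Type*} [Ring A] [Algebra ℂ A] (g : PowerSeries A) (n : ℕ) : A :=
  ∑ m ∈ Finset.range (n + 1), ((m.factorial : ℂ)⁻¹) • PowerSeries.coeff n (g ^ m)

/-- The series `∑_{k ≥ 1} (t ^ k / k) p_k`. -/
def powerSumSeries : PowerSeries Sym :=
  PowerSeries.mk fun k => match k with
    | 0 => 0
    | k + 1 => ((k + 1 : ℂ)⁻¹) • MvPolynomial.X k.succPNat

/-- The series `- ∑_{k ≥ 1} s ^ k ∂/∂p_k`, to be used with `s = t⁻¹`. -/
def derivationSeries : PowerSeries (Module.End ℂ Sym) :=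
  PowerSeries.mk fun k => match k with
    | 0 => 0
    | k + 1 => -(MvPolynomial.pderiv k.succPNat : Derivation ℂ Sym Sym).toLinearMap

/-- The coefficient of `t ^ a` in `exp (∑_{k ≥ 1} (t ^ k / k) p_k)`; it is `0` for `a < 0`. -/
def raisingCoeff (a : ℤ) : Sym :=
  if a < 0 then 0 else expCoeff powerSumSeries a.toNat

/-- The coefficient of `t ^ (-b)` in `exp (- ∑_{k ≥ 1} t ^ (-k) ∂/∂p_k)`. -/
def loweringCoeff (b : ℕ) : Module.End ℂ Sym :=
  expCoeff derivationSeries b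

/-- Polynomials of weight at most `z`, where `p_k` has weight `k`. -/
def weightLE (z : ℤ) : Submodule ℂ Sym :=
  Submodule.span ℂ {f | ∃ d : ℕ+ →₀ ℕ, (d.sum fun k e => (k : ℤ) * e) ≤ z ∧
    f = MvPolynomial.monomial d 1}

theorem weightLE_mono {y z : ℤ} (h : y ≤ z) : weightLE y ≤ weightLE z := by
  apply Submodule.span_mono
  rintro f ⟨d, hd, rfl⟩
  exact ⟨d, hd.trans h, rfl⟩

theorem eq_zero_of_mem_weightLE {z : ℤ} (hz : z < 0) {f : Sym} (hf : f ∈ weightLE z) :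
    f = 0 := by
  have : weightLE z ≤ ⊥ := by
    apply Submodule.span_le.2
    rintro f ⟨d, hd, rfl⟩
    have : (0 : ℤ) ≤ d.sum fun k e => (k : ℤ) * e :=
      Finset.sum_nonneg fun k _ => by positivity
    omega
  simpa using this hf

theorem exists_mem_weightLE (f : Sym) : ∃ z, f ∈ weightLE z := by
  induction f using MvPolynomial.induction_on' with
  | monomial d a =>
    refine ⟨d.sum fun k e => (k : ℤ) * e, ?_⟩
    have : (MvPolynomial.monomial d a : Sym) = a • MvPolynomial.monomial d 1 := by
      rw [MvPolynomial.smul_monomial]; simp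
    rw [this]
    exact Submodule.smul_mem _ _ (Submodule.subset_span ⟨d, le_rfl, rfl⟩)
  | add f g hf hg =>
    obtain ⟨y, hy⟩ := hf
    obtain ⟨z, hz⟩ := hg
    exact ⟨max y z, Submodule.add_mem _ (weightLE_mono (le_max_left _ _) hy)
      (weightLE_mono (le_max_right _ _) hz)⟩

theorem pderiv_mem_weightLE (k : ℕ+) {z : ℤ} {f : Sym} (hf : f ∈ weightLE z) :
    MvPolynomial.pderiv k f ∈ weightLE (z - k) := by
  have : weightLE z ≤ (weightLE (z - k)).comap
      (MvPolynomial.pderiv k : Derivation ℂ Sym Sym).toLinearMap := by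
    apply Submodule.span_le.2
    rintro f ⟨d, hd, rfl⟩
    change MvPolynomial.pderiv k (MvPolynomial.monomial d 1) ∈ weightLE (z - k)
    rw [MvPolynomial.pderiv_monomial]
    by_cases h0 : d k = 0
    · simp [h0]
    have hle : Finsupp.single k 1 ≤ d := by
      rw [Finsupp.single_le_iff]; omega
    have hsum : (d.sum fun k e => (k : ℤ) * e) =
        ((d - Finsupp.single k 1).sum fun k e => (k : ℤ) * e) + k := by
      conv_lhs => rw [← tsub_add_cancel_of_le hle]
      rw [Finsupp.sum_add_index' (by simp) (by intros; push_cast; ring)]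
      simp
    have : (MvPolynomial.monomial (d - Finsupp.single k 1) (1 * (d k : ℂ)) : Sym) =
        (d k : ℂ) • MvPolynomial.monomial (d - Finsupp.single k 1) 1 := by
      rw [MvPolynomial.smul_monomial]; simp
    rw [this]
    exact Submodule.smul_mem _ _ (Submodule.subset_span ⟨_, by omega, rfl⟩)
  exact this hf

theorem coeff_derivationSeries_pow_mem (m n : ℕ) {z : ℤ} {f : Sym} (hf : f ∈ weightLE z) :
    PowerSeries.coeff n (derivationSeries ^ m) f ∈ weightLE (z - n) := by
  induction m generalizing n z f with
  | zero =>
    rw [pow_zero, PowerSeries.coeff_one]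
    split_ifs with h
    · subst h; simpa using hf
    · simp
  | succ m ih =>
    rw [pow_succ, PowerSeries.coeff_mul, LinearMap.sum_apply]
    refine Submodule.sum_mem _ fun ab hab => ?_
    rw [Finset.HasAntidiagonal.mem_antidiagonal] at hab
    have h1 : PowerSeries.coeff ab.2 derivationSeries f ∈ weightLE (z - ab.2) := by
      rw [derivationSeries, PowerSeries.coeff_mk]
      rcases ab.2 with _ | k
      · simp
      · have := pderiv_mem_weightLE k.succPNat hf
        simpa using this
    have h2 := ih ab.1 h1
    rw [Module.End.mul_apply]
    have h3 : z - ab.2 - ab.1 = z - n := by omega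
    rwa [h3] at h2

/-- Only finitely many of the lowering coefficients act nontrivially on a given element. -/
theorem finite_support (n : ℤ) (f : Sym) :
    (Function.support fun b : ℕ => raisingCoeff (n + b) * loweringCoeff b f).Finite := by
  obtain ⟨z, hz⟩ := exists_mem_weightLE f
  refine (Set.finite_Iic z.toNat).subset fun b hb => ?_
  by_contra hlt
  rw [Set.mem_Iic, not_le] at hlt
  refine hb ?_
  have : loweringCoeff b f = 0 := by
    rw [loweringCoeff, expCoeff, LinearMap.sum_apply]
    refine Finset.sum_eq_zero fun m _ => ?_
    rw [LinearMap.smul_apply, eq_zero_of_mem_weightLE (by omega)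
      (coeff_derivationSeries_pow_mem m b hz), smul_zero]
  simp [this]

/-- The Bernstein operator `B_n`: the coefficient of `t ^ n` in
`exp (∑_{k ≥ 1} (t ^ k / k) p_k) exp (- ∑_{k ≥ 1} t ^ (-k) ∂/∂p_k)`, as a linear operator on `Λ`.
The sum over `b` is finite on each element. -/
def bernstein (n : ℤ) : Module.End ℂ Sym where
  toFun f := ∑ᶠ b : ℕ, raisingCoeff (n + b) * loweringCoeff b f
  map_add' f g := by
    rw [← finsum_add_distrib (finite_support n f) (finite_support n g)]
    simp [mul_add]
  map_smul' c f := by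
    rw [RingHom.id_apply, smul_finsum' c (finite_support n f)]
    simp

/-- `B_μ = B_{μ₁} B_{μ₂} ⋯ B_{μ_l}` for a finite sequence of integers `μ`
(the product is composition of operators). -/
def bernsteinProd (mu : List ℤ) : Module.End ℂ Sym := (mu.map bernstein).prod

/-- `B_λ` for a finite sequence of natural numbers. -/
def bernsteinPart (lam : List ℕ) : Module.End ℂ Sym :=
  bernsteinProd (lam.map fun a => (a : ℤ))

end BernsteinCode

end

/-! Everything rests on the exchange relation `B_n B_m = -B_{m-1} B_{n+1}`. The lowering exponential
in `s = t⁻¹` shifts each `p_k` by `-s ^ k`, so moving it past the raising exponential in `u` costs a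
factor `1 - s u` (`loweringInt_raisingCoeff_mul`). Hence `B_n B_m` is a difference of two normally
ordered products, which are symmetric in their indices (`bernstein_mul_bernstein`).

Up to a shift, the `U`s of the code sit at the positions `λ_i - i` (`isCode_iff`). The rightmost is
at `λ_1 - 1`, so `ζ` is at position `n`. Moving `B_n` past the first `r` factors of `B_λ` lowers
each of them by one, turns `B_n` into `B_{n+r}` and gives the sign `(-1)^r`. If `n = λ_{r+1} -
(r+1)` with `r < l`, it then meets `B_{n+r+1}`, and this product vanishes. If `ζ` is a `U` below row
`l`, then `n < -l`; after all `l` factors the index is still negative, which kills `1`. If `ζ = R`,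
take `r` to be the number of `U`s to its right: the new index sequence is a partition whose code has
the extra `U`, and `r = j + 1`. -/

noncomputable section

namespace BernsteinCode

/-! ### Exponentials of power series over a noncommutative ring -/

section ExpCoeff

variable {A : Type*} [Ring A]

/-- The Euler operator `t d/dt` on power series over a possibly noncommutative ring. -/
def eulerOp (g : PowerSeries A) : PowerSeries A :=
  PowerSeries.mk fun n => n • PowerSeries.coeff n g

theorem eulerOp_mul (f g : PowerSeries A) :
    eulerOp (f * g) = eulerOp f * g + f * eulerOp g := by
  ext n
  simp only [eulerOp, PowerSeries.coeff_mk, map_add, PowerSeries.coeff_mul, Finset.smul_sum,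
    ← Finset.sum_add_distrib]
  refine Finset.sum_congr rfl fun x hx => ?_
  rw [← Finset.HasAntidiagonal.mem_antidiagonal.1 hx, add_smul, smul_mul_assoc, mul_smul_comm]

theorem eulerOp_pow_succ {g : PowerSeries A} (hg : Commute g (eulerOp g)) (m : ℕ) :
    eulerOp (g ^ (m + 1)) = (m + 1) • (eulerOp g * g ^ m) := by
  induction m with
  | zero => simp
  | succ m ih =>
    rw [pow_succ, eulerOp_mul, ih, smul_mul_assoc, mul_assoc, ← pow_succ,
      (hg.pow_left (m + 1)).eq, succ_nsmul _ (m + 1)]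

theorem coeff_pow_eq_zero_of_lt {g : PowerSeries A} (h0 : PowerSeries.coeff 0 g = 0) {n m : ℕ}
    (h : n < m) : PowerSeries.coeff n (g ^ m) = 0 := by
  induction m generalizing n with
  | zero => omega
  | succ m ih =>
    rw [pow_succ, PowerSeries.coeff_mul]
    refine Finset.sum_eq_zero fun x hx => ?_
    have := Finset.HasAntidiagonal.mem_antidiagonal.1 hx
    rcases Nat.eq_zero_or_pos x.2 with h2 | h2
    · rw [h2, h0, mul_zero]
    · rw [ih (by omega), zero_mul]

theorem commute_of_commute_coeff {f g : PowerSeries A}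
    (h : ∀ i j, Commute (PowerSeries.coeff i f) (PowerSeries.coeff j g)) : Commute f g := by
  ext n
  rw [PowerSeries.coeff_mul, PowerSeries.coeff_mul, ← Finset.Nat.sum_antidiagonal_swap]
  exact Finset.sum_congr rfl fun x _ => (h _ _).eq

variable [Algebra ℂ A]

/-- The cutoff in the definition depends on `n`; a common one allows sums to be interchanged. -/
theorem expCoeff_eq_sum_range {g : PowerSeries A} (h0 : PowerSeries.coeff 0 g = 0) {n N : ℕ}
    (h : n < N) : expCoeff g n =
      ∑ m ∈ Finset.range N, ((m.factorial : ℂ)⁻¹) • PowerSeries.coeff n (g ^ m) := by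
  refine Finset.sum_subset (Finset.range_subset_range.2 h) fun m _ hm => ?_
  rw [coeff_pow_eq_zero_of_lt h0 (by simpa using hm), smul_zero]

theorem expCoeff_zero (g : PowerSeries A) : expCoeff g 0 = 1 := by
  simp [expCoeff]

/-- The recurrence for the coefficients of an exponential, from
`t d/dt exp g = (t d/dt g) exp g`. -/
theorem nsmul_expCoeff {g : PowerSeries A} (h0 : PowerSeries.coeff 0 g = 0)
    (hg : Commute g (eulerOp g)) (n : ℕ) :
    n • expCoeff g n =
      ∑ x ∈ Finset.HasAntidiagonal.antidiagonal n,
        (x.1 • PowerSeries.coeff x.1 g) * expCoeff g x.2 := by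
  have hR : ∀ x ∈ Finset.HasAntidiagonal.antidiagonal n,
      (x.1 • PowerSeries.coeff x.1 g) * expCoeff g x.2 =
      ∑ m ∈ Finset.range (n + 1), ((m.factorial : ℂ)⁻¹) •
        (PowerSeries.coeff x.1 (eulerOp g) * PowerSeries.coeff x.2 (g ^ m)) := by
    intro x hx
    have := Finset.HasAntidiagonal.mem_antidiagonal.1 hx
    rw [expCoeff_eq_sum_range h0 (N := n + 1) (by omega), Finset.mul_sum]
    simp [eulerOp]
  -- The left side is cut off at `n + 2`: splitting off `m = 0` leaves the range `n + 1` of the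
  -- right side, and `(m + 1) / (m + 1)! = 1 / m!` matches the terms.
  rw [Finset.sum_congr rfl hR, Finset.sum_comm,
    expCoeff_eq_sum_range h0 (N := n + 2) (by omega), Finset.sum_range_succ']
  simp only [← Finset.smul_sum, ← PowerSeries.coeff_mul]
  rw [smul_add, Finset.smul_sum]
  have hz : n • (((Nat.factorial 0 : ℕ) : ℂ)⁻¹ • PowerSeries.coeff n (g ^ 0)) = 0 := by
    rw [pow_zero, PowerSeries.coeff_one]
    split_ifs with h <;> simp [h]
  rw [hz, add_zero]
  refine Finset.sum_congr rfl fun m _ => ?_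
  have h1 : n • PowerSeries.coeff n (g ^ (m + 1)) = PowerSeries.coeff n (eulerOp (g ^ (m + 1))) := by
    simp [eulerOp]
  rw [smul_comm, h1, eulerOp_pow_succ hg, map_nsmul, ← Nat.cast_smul_eq_nsmul ℂ, smul_smul]
  congr 1
  have : (m.factorial : ℂ) ≠ 0 := by exact_mod_cast m.factorial_ne_zero
  have : ((m : ℂ) + 1) ≠ 0 := by exact_mod_cast m.succ_ne_zero
  rw [Nat.factorial_succ]
  push_cast
  field_simp

theorem commute_expCoeff {g : PowerSeries A} (h0 : PowerSeries.coeff 0 g = 0)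
    (hg : Commute g (eulerOp g)) {x : A} (hx : ∀ k, Commute x (PowerSeries.coeff k g)) (n : ℕ) :
    Commute x (expCoeff g n) := by
  induction n using Nat.strong_induction_on with
  | _ n ih =>
    rcases Nat.eq_zero_or_pos n with rfl | hn
    · rw [expCoeff_zero]; exact Commute.one_right x
    have h1 : Commute x (n • expCoeff g n) := by
      rw [nsmul_expCoeff h0 hg]
      refine Commute.sum_right _ _ _ fun y hy => ?_
      have := Finset.HasAntidiagonal.mem_antidiagonal.1 hy
      rcases Nat.eq_zero_or_pos y.1 with h2 | h2
      · simp [h2]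
      · exact ((hx _).smul_right _).mul_right (ih _ (by omega))
    have h2 : expCoeff g n = (n : ℂ)⁻¹ • (n • expCoeff g n) := by
      rw [← Nat.cast_smul_eq_nsmul ℂ, smul_smul, inv_mul_cancel₀ (Nat.cast_ne_zero.2 hn.ne'),
        one_smul]
    rw [h2]
    exact h1.smul_right _

/-- The coefficient of `t ^ a` in `exp g`, which is `0` for negative `a`. -/
def expCoeffInt (g : PowerSeries A) (a : ℤ) : A :=
  if a < 0 then 0 else expCoeff g a.toNat

theorem expCoeffInt_of_neg (g : PowerSeries A) {a : ℤ} (ha : a < 0) : expCoeffInt g a = 0 :=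
  if_pos ha

theorem expCoeffInt_natCast (g : PowerSeries A) (n : ℕ) : expCoeffInt g n = expCoeff g n := by
  rw [expCoeffInt, if_neg (by omega), Int.toNat_natCast]

theorem expCoeffInt_zero (g : PowerSeries A) : expCoeffInt g 0 = 1 := by
  simpa [expCoeff_zero] using expCoeffInt_natCast g 0

/-- Coefficients of negative index vanish, so any bound `N ≥ a` serves as cutoff. -/
theorem smul_expCoeffInt {g : PowerSeries A} (h0 : PowerSeries.coeff 0 g = 0)
    (hg : Commute g (eulerOp g)) {a : ℤ} {N : ℕ} (haN : a ≤ N) :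
    (a : ℂ) • expCoeffInt g a = ∑ j ∈ Finset.range N,
      (((j + 1 : ℕ) : ℂ) • PowerSeries.coeff (j + 1) g) * expCoeffInt g (a - (j + 1)) := by
  rcases lt_or_ge a 0 with ha | ha
  · rw [expCoeffInt_of_neg g ha, smul_zero]
    refine (Finset.sum_eq_zero fun j _ => ?_).symm
    rw [expCoeffInt_of_neg g (by omega), mul_zero]
  lift a to ℕ using ha
  have hsub : ∑ j ∈ Finset.range a,
      (((j + 1 : ℕ) : ℂ) • PowerSeries.coeff (j + 1) g) * expCoeffInt g ((a : ℤ) - (j + 1)) =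
      ∑ j ∈ Finset.range N,
        (((j + 1 : ℕ) : ℂ) • PowerSeries.coeff (j + 1) g) * expCoeffInt g ((a : ℤ) - (j + 1)) := by
    refine Finset.sum_subset (Finset.range_subset_range.2 (by omega)) fun j _ hj => ?_
    rw [Finset.mem_range] at hj
    rw [expCoeffInt_of_neg g (by omega), mul_zero]
  rw [← hsub, expCoeffInt_natCast, Int.cast_natCast, Nat.cast_smul_eq_nsmul, nsmul_expCoeff h0 hg,
    Finset.Nat.sum_antidiagonal_eq_sum_range_succ_mk, Finset.sum_range_succ']
  simp only [h0, smul_zero, zero_mul, add_zero]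
  refine Finset.sum_congr rfl fun j hj => ?_
  rw [Finset.mem_range] at hj
  rw [Nat.cast_smul_eq_nsmul, ← expCoeffInt_natCast]
  congr 2
  omega

end ExpCoeff

/-! ## The complete symmetric functions and the lowering operators -/

/-- `∂/∂p_{j+1}` as a linear operator. -/
def pd (j : ℕ) : Module.End ℂ Sym :=
  (MvPolynomial.pderiv j.succPNat : Derivation ℂ Sym Sym).toLinearMap

theorem pd_mul (j : ℕ) (f g : Sym) : pd j (f * g) = f * pd j g + g * pd j f := by
  simp [pd, Derivation.leibniz]

theorem pd_X (i j : ℕ) : pd i (MvPolynomial.X j.succPNat) = if j = i then 1 else 0 := by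
  simp [pd, MvPolynomial.pderiv_X, Pi.single_apply]

theorem commute_pd (i j : ℕ) : Commute (pd i) (pd j) := by
  have : ⁅(MvPolynomial.pderiv i.succPNat : Derivation ℂ Sym Sym),
      (MvPolynomial.pderiv j.succPNat : Derivation ℂ Sym Sym)⁆ = 0 := by
    refine MvPolynomial.derivation_ext fun k => ?_
    rw [Derivation.commutator_apply, MvPolynomial.pderiv_X, MvPolynomial.pderiv_X,
      Pi.single_apply, Pi.single_apply]
    split_ifs <;> simp
  refine LinearMap.ext fun f => ?_
  have h := congrArg (fun D : Derivation ℂ Sym Sym => D f) this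
  rw [Derivation.commutator_apply] at h
  exact sub_eq_zero.1 h

theorem coeff_zero_powerSumSeries : PowerSeries.coeff 0 powerSumSeries = 0 := by
  simp [powerSumSeries]

theorem coeff_zero_derivationSeries : PowerSeries.coeff 0 derivationSeries = 0 := by
  simp [derivationSeries]

theorem coeff_succ_derivationSeries (j : ℕ) :
    PowerSeries.coeff (j + 1) derivationSeries = -pd j := by
  simp [derivationSeries, pd]

theorem commute_coeff_derivationSeries (i j : ℕ) :
    Commute (PowerSeries.coeff i derivationSeries) (PowerSeries.coeff j derivationSeries) := by
  cases i with
  | zero => rw [coeff_zero_derivationSeries]; exact Commute.zero_left _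
  | succ i =>
    cases j with
    | zero => rw [coeff_zero_derivationSeries]; exact Commute.zero_right _
    | succ j =>
      rw [coeff_succ_derivationSeries, coeff_succ_derivationSeries]
      exact (commute_pd i j).neg_left.neg_right

theorem commute_derivationSeries_eulerOp : Commute derivationSeries (eulerOp derivationSeries) :=
  commute_of_commute_coeff fun i j => by
    rw [eulerOp, PowerSeries.coeff_mk]
    exact (commute_coeff_derivationSeries i j).smul_right _

theorem commute_loweringCoeff (b c : ℕ) : Commute (loweringCoeff b) (loweringCoeff c) :=
  commute_expCoeff coeff_zero_derivationSeries commute_derivationSeries_eulerOp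
    (fun k => (commute_expCoeff coeff_zero_derivationSeries commute_derivationSeries_eulerOp
      (fun i => commute_coeff_derivationSeries k i) b).symm) c

theorem raisingCoeff_of_neg {a : ℤ} (ha : a < 0) : raisingCoeff a = 0 := if_pos ha

/-- Newton's identity `a h_a = ∑ p_k h_{a-k}`. -/
theorem smul_raisingCoeff {a : ℤ} {N : ℕ} (haN : a ≤ N) :
    (a : ℂ) • raisingCoeff a = ∑ j ∈ Finset.range N,
      MvPolynomial.X j.succPNat * raisingCoeff (a - (j + 1)) := by
  have h := smul_expCoeffInt coeff_zero_powerSumSeries (Commute.all _ _) haN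
  refine h.trans (Finset.sum_congr rfl fun j _ => ?_)
  have hj : ((j + 1 : ℕ) : ℂ) • PowerSeries.coeff (j + 1) powerSumSeries =
      MvPolynomial.X j.succPNat := by
    have h0 : ((j : ℂ) + 1) ≠ 0 := by exact_mod_cast j.succ_ne_zero
    rw [powerSumSeries, PowerSeries.coeff_mk, smul_smul, Nat.cast_succ, mul_inv_cancel₀ h0,
      one_smul]
  rw [hj]
  rfl

/-- Coefficient form of `k ∂H/∂p_k = t ^ k H`. Differentiating Newton's identity gives `(a - k)
h_{a-k} + k h_{a-k}` by induction, and one divides by `a`. -/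
theorem pd_raisingCoeff (i : ℕ) (a : ℤ) :
    ((i + 1 : ℕ) : ℂ) • pd i (raisingCoeff a) = raisingCoeff (a - (i + 1)) := by
  obtain ⟨n, hn⟩ : ∃ n : ℕ, a < n := ⟨(a + 1).toNat, by omega⟩
  induction n using Nat.strong_induction_on generalizing a with
  | _ n ih =>
    rcases lt_trichotomy a 0 with ha | rfl | ha
    · rw [raisingCoeff_of_neg ha, raisingCoeff_of_neg (by omega), map_zero,
    smul_zero]
    · rw [raisingCoeff_of_neg (a := 0 - (i + 1 : ℤ)) (by omega)]
      have : raisingCoeff 0 = 1 := expCoeffInt_zero _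
      simp [this, pd]
    have ha' : (a : ℂ) ≠ 0 := by exact_mod_cast ha.ne'
    have hi : i ∈ Finset.range (n + i + 1) := by simp
    have h1 := congrArg (fun f => ((i + 1 : ℕ) : ℂ) • pd i f)
      (smul_raisingCoeff (a := a) (N := n + i + 1) (by omega))
    have h2 := smul_raisingCoeff (a := a - (i + 1)) (N := n + i + 1) (by omega)
    have h3 : ∀ j ∈ Finset.range (n + i + 1), ((i + 1 : ℕ) : ℂ) •
        pd i (MvPolynomial.X j.succPNat * raisingCoeff (a - (j + 1))) =
        MvPolynomial.X j.succPNat * raisingCoeff (a - (i + 1) - (j + 1)) +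
        if j = i then ((i + 1 : ℕ) : ℂ) • raisingCoeff (a - (i + 1)) else 0 := by
      intro j _
      have := ih (n - 1) (by omega) (a - (j + 1)) (by omega)
      rw [pd_mul, smul_add, ← mul_smul_comm, this, pd_X, sub_right_comm]
      split_ifs with h
      · subst h; simp
      · simp
    simp only [map_smul, map_sum, Finset.smul_sum] at h1
    rw [Finset.sum_congr rfl h3, Finset.sum_add_distrib, ← h2, Finset.sum_ite_eq' , if_pos hi,
      ← add_smul, smul_comm] at h1
    have h4 : ((a - (i + 1) : ℤ) : ℂ) + ((i + 1 : ℕ) : ℂ) = a := by push_cast; ring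
    rw [h4] at h1
    exact smul_right_injective _ ha' h1

/-- The coefficient of `t ^ (-b)` in `exp (- ∑ t ^ (-k) ∂/∂p_k)`, for an integer `b`. -/
def loweringInt (b : ℤ) : Module.End ℂ Sym := expCoeffInt derivationSeries b

theorem smul_loweringInt {b : ℤ} {N : ℕ} (hbN : b ≤ N) (f : Sym) :
    (b : ℂ) • loweringInt b f = -∑ j ∈ Finset.range N,
      ((j + 1 : ℕ) : ℂ) • pd j (loweringInt (b - (j + 1)) f) := by
  have h := congrArg (fun T : Module.End ℂ Sym => T f)
    (smul_expCoeffInt coeff_zero_derivationSeries commute_derivationSeries_eulerOp hbN)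
  simp only [LinearMap.smul_apply, LinearMap.sum_apply, coeff_succ_derivationSeries] at h
  refine h.trans ?_
  rw [← Finset.sum_neg_distrib]
  refine Finset.sum_congr rfl fun j _ => ?_
  rw [Module.End.mul_apply, smul_neg, LinearMap.neg_apply, LinearMap.smul_apply]
  rfl

/-- The commutation rule of lowering operators with multiplication by complete symmetric
functions. -/
theorem loweringInt_raisingCoeff_mul (b a : ℤ) (f : Sym) :
    loweringInt b (raisingCoeff a * f) =
      raisingCoeff a * loweringInt b f - raisingCoeff (a - 1) * loweringInt (b - 1) f := by
  obtain ⟨n, hn⟩ : ∃ n : ℕ, b < n := ⟨(b + 1).toNat, by omega⟩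
  induction n using Nat.strong_induction_on generalizing b with
  | _ n ih =>
    have hneg : ∀ c : ℤ, c < 0 → loweringInt c = 0 := fun c hc => expCoeffInt_of_neg _ hc
    rcases lt_trichotomy b 0 with hb | rfl | hb
    · simp [hneg b hb, hneg (b - 1) (by omega)]
    · have : loweringInt 0 = 1 := expCoeffInt_zero _
      simp [hneg (-1) (by omega), this]
    have hb' : (b : ℂ) ≠ 0 := by exact_mod_cast hb.ne'
    refine smul_right_injective _ hb' ?_
    change (b : ℂ) • _ = (b : ℂ) • _
    rw [smul_loweringInt (N := n) hn.le]
    -- The terms in which the derivative hits `f` refold into multiples `b` and `b - 1` by the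
    -- recurrence. Those in which it hits a raising coefficient telescope, supplying the missing
    -- copy of the second term.
    have h1 : ∀ j ∈ Finset.range n, ((j + 1 : ℕ) : ℂ) •
        pd j (loweringInt (b - (j + 1)) (raisingCoeff a * f)) =
        raisingCoeff a * (((j + 1 : ℕ) : ℂ) • pd j (loweringInt (b - (j + 1)) f)) -
        raisingCoeff (a - 1) * (((j + 1 : ℕ) : ℂ) • pd j (loweringInt (b - 1 - (j + 1)) f)) +
        (raisingCoeff (a - 1 - (j : ℕ)) * loweringInt (b - 1 - (j : ℕ)) f -
         raisingCoeff (a - 1 - (j + 1 : ℕ)) * loweringInt (b - 1 - (j + 1 : ℕ)) f) := by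
      intro j _
      rw [ih (n - 1) (by omega) (b - (j + 1)) (by omega), map_sub, pd_mul, pd_mul, smul_sub,
        smul_add, smul_add]
      have e1 : ((j + 1 : ℕ) : ℂ) • (loweringInt (b - (j + 1)) f * pd j (raisingCoeff a)) =
          loweringInt (b - (j + 1)) f * raisingCoeff (a - (j + 1)) := by
        rw [← mul_smul_comm, pd_raisingCoeff]
      have e2 : ((j + 1 : ℕ) : ℂ) •
          (loweringInt (b - (j + 1) - 1) f * pd j (raisingCoeff (a - 1))) =
          loweringInt (b - (j + 1) - 1) f * raisingCoeff (a - 1 - (j + 1)) := by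
        rw [← mul_smul_comm, pd_raisingCoeff]
      have e3 : b - 1 - ((j + 1 : ℕ) : ℤ) = b - (j + 1) - 1 := by push_cast; ring
      have e4 : b - 1 - (j : ℤ) = b - (j + 1) := by ring
      have e5 : a - 1 - (j : ℤ) = a - (j + 1) := by ring
      have e6 : b - 1 - ((j : ℤ) + 1) = b - (j + 1) - 1 := by ring
      rw [e1, e2, e3, e4, e5, e6, mul_smul_comm, mul_smul_comm]
      push_cast
      ring
    rw [Finset.sum_congr rfl h1, Finset.sum_add_distrib, Finset.sum_sub_distrib,
      ← Finset.mul_sum, ← Finset.mul_sum,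
      Finset.sum_range_sub' (fun j : ℕ => raisingCoeff (a - 1 - (j : ℕ)) *
        loweringInt (b - 1 - (j : ℕ)) f) n]
    have s1 := smul_loweringInt (N := n) hn.le f
    have s2 := smul_loweringInt (b := b - 1) (N := n) (by omega) f
    rw [← neg_eq_iff_eq_neg] at s1 s2
    rw [← s1, ← s2, hneg (b - 1 - (n : ℕ)) (by omega), Int.cast_sub, sub_smul]
    simp only [Nat.cast_zero, sub_zero, LinearMap.zero_apply, mul_zero, Int.cast_one, one_smul,
      mul_neg, mul_smul_comm, mul_sub, smul_sub]
    ring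

/-! ## The exchange relation -/

theorem exists_loweringCoeff_eq_zero (f : Sym) : ∃ N, ∀ b : ℕ, N ≤ b → loweringCoeff b f = 0 := by
  obtain ⟨z, hz⟩ := exists_mem_weightLE f
  refine ⟨(z + 1).toNat, fun b hb => ?_⟩
  rw [loweringCoeff, expCoeff, LinearMap.sum_apply]
  refine Finset.sum_eq_zero fun m _ => ?_
  rw [LinearMap.smul_apply, eq_zero_of_mem_weightLE (by omega)
    (coeff_derivationSeries_pow_mem m b hz), smul_zero]

theorem bernstein_apply (n : ℤ) {f : Sym} {N : ℕ} (hN : ∀ b : ℕ, N ≤ b → loweringCoeff b f = 0) :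
    bernstein n f = ∑ b ∈ Finset.range N, raisingCoeff (n + b) * loweringCoeff b f := by
  refine finsum_eq_sum_of_support_subset _ fun b hb => ?_
  by_contra h
  exact hb (by simp [hN b (by simpa using h)])

/-- The normally ordered product, truncated to `N` terms in each lowering index. -/
def normalOrdered (N : ℕ) (x y : ℤ) (f : Sym) : Sym :=
  ∑ b ∈ Finset.range N, ∑ c ∈ Finset.range N,
    raisingCoeff (x + b) * raisingCoeff (y + c) * loweringCoeff b (loweringCoeff c f)

/-- Lowering operators commute with each other, and so do multiplications. -/
theorem normalOrdered_comm (N : ℕ) (x y : ℤ) (f : Sym) :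
    normalOrdered N x y f = normalOrdered N y x f := by
  rw [normalOrdered, Finset.sum_comm]
  refine Finset.sum_congr rfl fun b _ => Finset.sum_congr rfl fun c _ => ?_
  have h := congrArg (fun T : Module.End ℂ Sym => T f) (commute_loweringCoeff b c).eq
  simp only [Module.End.mul_apply] at h
  rw [h, mul_comm (raisingCoeff _)]

theorem loweringInt_natCast (b : ℕ) : loweringInt b = loweringCoeff b := expCoeffInt_natCast _ _

theorem bernstein_bernstein_apply (n m : ℤ) {f : Sym} {N : ℕ}
    (hN : ∀ b : ℕ, N ≤ b → loweringCoeff b f = 0)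
    (hN' : ∀ b : ℕ, N ≤ b → loweringCoeff b (bernstein m f) = 0) :
    bernstein n (bernstein m f) =
      normalOrdered (N + 1) n m f - normalOrdered (N + 1) (n + 1) (m - 1) f := by
  have h1 : ∀ b c : ℕ, raisingCoeff (n + b) * loweringCoeff b (raisingCoeff (m + c) *
      loweringCoeff c f) = raisingCoeff (n + b) * raisingCoeff (m + c) *
        loweringCoeff b (loweringCoeff c f) -
      raisingCoeff (n + b) * raisingCoeff (m - 1 + c) *
        loweringInt ((b : ℤ) - 1) (loweringCoeff c f) := by
    intro b c
    rw [← loweringInt_natCast b, loweringInt_raisingCoeff_mul,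
      show m + (c : ℤ) - 1 = m - 1 + c by ring]
    ring
  have hz : ∀ c : ℕ, loweringCoeff N (loweringCoeff c f) = 0 := fun c => by
    have h := congrArg (fun T : Module.End ℂ Sym => T f) (commute_loweringCoeff N c).eq
    simp only [Module.End.mul_apply] at h
    rw [h, hN N le_rfl, map_zero]
  rw [bernstein_apply n (N := N + 1) (fun b hb => hN' b (by omega)),
    bernstein_apply m (N := N + 1) (fun b hb => hN b (by omega))]
  simp only [map_sum, Finset.mul_sum, h1, Finset.sum_sub_distrib]
  rw [← normalOrdered]
  refine congrArg (normalOrdered (N + 1) n m f - ·) ?_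
  -- Reindexing by `b + 1` leaves one boundary term on each side: lowering index `-1` on the left,
  -- and `N` on the right, beyond the support of `f`. Both vanish.
  refine (Finset.sum_range_succ' _ N).trans (Eq.trans ?_ (Finset.sum_range_succ _ N).symm)
  refine congrArg₂ (· + ·) ?_ ?_
  · refine Finset.sum_congr rfl fun b _ => Finset.sum_congr rfl fun c _ => ?_
    rw [Nat.cast_succ, add_sub_cancel_right, loweringInt_natCast,
      show n + ((b : ℤ) + 1) = n + 1 + b by ring]
  · rw [Finset.sum_eq_zero, Finset.sum_eq_zero]
    · intro c _; rw [hz, mul_zero]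
    · intro c _
      rw [loweringInt, expCoeffInt_of_neg _ (by simp), LinearMap.zero_apply, mul_zero]

/-- The exchange relation of Bernstein operators. -/
theorem bernstein_mul_bernstein (n m : ℤ) :
    bernstein n * bernstein m = (-1 : ℂ) • (bernstein (m - 1) * bernstein (n + 1)) := by
  refine LinearMap.ext fun f => ?_
  obtain ⟨N₁, h₁⟩ := exists_loweringCoeff_eq_zero f
  obtain ⟨N₂, h₂⟩ := exists_loweringCoeff_eq_zero (bernstein m f)
  obtain ⟨N₃, h₃⟩ := exists_loweringCoeff_eq_zero (bernstein (n + 1) f)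
  have hf : ∀ b : ℕ, N₁ + N₂ + N₃ ≤ b → loweringCoeff b f = 0 := fun b hb => h₁ b (by omega)
  rw [LinearMap.smul_apply, Module.End.mul_apply, Module.End.mul_apply,
    bernstein_bernstein_apply n m hf (fun b hb => h₂ b (by omega)),
    bernstein_bernstein_apply (m - 1) (n + 1) hf (fun b hb => h₃ b (by omega)),
    normalOrdered_comm _ (m - 1), normalOrdered_comm _ (m - 1 + 1), sub_add_cancel,
    add_sub_cancel_right, neg_one_smul, neg_sub]

/-- For `m = n + 1` the exchange relation reads `X = -X`. -/
theorem bernstein_mul_bernstein_succ (n : ℤ) : bernstein n * bernstein (n + 1) = 0 := by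
  have h := bernstein_mul_bernstein n (n + 1)
  rw [add_sub_cancel_right] at h
  have h2 : (2 : ℂ) • (bernstein n * bernstein (n + 1)) = 0 := by
    calc _ = (bernstein n * bernstein (n + 1)) - (-1 : ℂ) • (bernstein n * bernstein (n + 1)) := by
          module
      _ = 0 := sub_eq_zero.2 h
  exact (smul_eq_zero.1 h2).resolve_left two_ne_zero

/-- Since `1` has weight `0`, only the lowering index `0` survives, leaving a raising coefficient of
negative index. -/
theorem bernstein_one_of_neg {n : ℤ} (hn : n < 0) : bernstein n 1 = 0 := by
  have h : ∀ b : ℕ, 1 ≤ b → loweringCoeff b (1 : Sym) = 0 := by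
    intro b hb
    have h1 : (1 : Sym) ∈ weightLE 0 := Submodule.subset_span ⟨0, by simp, rfl⟩
    rw [loweringCoeff, expCoeff, LinearMap.sum_apply]
    refine Finset.sum_eq_zero fun m _ => ?_
    rw [LinearMap.smul_apply, eq_zero_of_mem_weightLE (by omega)
      (coeff_derivationSeries_pow_mem m b h1), smul_zero]
  rw [bernstein_apply n h]
  simp [raisingCoeff_of_neg hn]

theorem bernsteinProd_cons (x : ℤ) (ys : List ℤ) :
    bernsteinProd (x :: ys) = bernstein x * bernsteinProd ys := by
  simp [bernsteinProd]

/-- Moving a Bernstein operator to the right through a product. -/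
theorem bernstein_mul_bernsteinProd (n : ℤ) (xs : List ℤ) :
    bernstein n * bernsteinProd xs = (-1 : ℂ) ^ xs.length •
      (bernsteinProd (xs.map (· - 1)) * bernstein (n + xs.length)) := by
  induction xs generalizing n with
  | nil => simp [bernsteinProd]
  | cons x xs ih =>
    rw [bernsteinProd_cons, ← mul_assoc, bernstein_mul_bernstein, smul_mul_assoc,
      mul_assoc, ih, List.map_cons, bernsteinProd_cons, List.length_cons, pow_succ', mul_smul_comm,
      smul_smul, mul_assoc, Nat.cast_succ, add_assoc n 1, add_comm (1 : ℤ)]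

/-! ## Codes as sets of positions -/

/-- The position of the up step of row `r + 1` in the code, normalised so that the step from the
point `(x, y)` has position `x + y`. -/
def upPos (lam : List ℕ) (r : ℕ) : ℤ := (lam.getD r 0 : ℤ) - (r + 1)

theorem IsPartition.antitone_getD {lam : List ℕ} (h : IsPartition lam) :
    Antitone fun r => lam.getD r 0 := by
  intro r s hrs
  rcases hrs.eq_or_lt with rfl | hlt
  · exact le_rfl
  change lam.getD s 0 ≤ lam.getD r 0
  rcases lt_or_ge s lam.length with hs | hs
  · rw [List.getD_eq_getElem _ _ hs, List.getD_eq_getElem _ _ (hlt.trans hs)]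
    exact List.pairwise_iff_getElem.1 h r s _ _ hlt
  · rw [List.getD_eq_default _ _ hs]; exact Nat.zero_le _

theorem isPartition_of_antitone_getD {lam : List ℕ} (h : Antitone fun r => lam.getD r 0) :
    IsPartition lam := by
  refine List.pairwise_iff_getElem.2 fun r s hr hs hrs => ?_
  have := h hrs.le
  simp only [List.getD_eq_getElem _ _ hr, List.getD_eq_getElem _ _ hs] at this
  exact this

theorem IsPartition.strictAnti_upPos {lam : List ℕ} (h : IsPartition lam) :
    StrictAnti (upPos lam) := by
  intro r s hrs
  have : lam.getD s 0 ≤ lam.getD r 0 := h.antitone_getD hrs.le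
  simp only [upPos]
  omega

theorem upPos_of_length_le {lam : List ℕ} {r : ℕ} (h : lam.length ≤ r) :
    upPos lam r = -(r + 1 : ℤ) := by
  rw [upPos, List.getD_eq_default _ _ h]; simp

theorem exists_upPos_lt (lam : List ℕ) (s : ℤ) : ∃ r, upPos lam r < s := by
  refine ⟨lam.length + s.natAbs, ?_⟩
  rw [upPos_of_length_le (by omega)]
  omega

/-- `w` is a code of `lam` if and only if, up to a shift, its `U`s are in the positions
`λ_i - i`. -/
theorem isCode_iff {lam : List ℕ} (hlam : IsPartition lam) {w : ℤ → Letter} :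
    IsCode lam w ↔ ∃ c : ℤ, ∀ i, w i = Letter.U ↔ ∃ r, upPos lam r = i + c := by
  have hanti := hlam.strictAnti_upPos
  constructor
  · rintro ⟨P, hP, hstep⟩
    refine ⟨(P 0).1 + (P 0).2, fun i => ?_⟩
    -- Either kind of step increases `x + y` by one, so this sum is the position up to a constant.
    have hsum : ∀ i : ℤ, (P i).1 + (P i).2 = i + ((P 0).1 + (P 0).2) := by
      have hs : ∀ i, (P (i + 1)).1 + (P (i + 1)).2 = (P i).1 + (P i).2 + 1 := by
        intro i
        rw [hstep i]
        cases w i <;> simp [Letter.vec] <;> ring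
      intro i
      induction i with
      | zero => simp
      | succ i ih => rw [hs, ih]; ring
      | pred i ih =>
        have := hs (-(i : ℤ) - 1)
        rw [sub_add_cancel] at this
        linarith
    obtain ⟨r, hr, hle, hge⟩ := hP i
    obtain ⟨r', hr', hle', hge'⟩ := hP (i + 1)
    have hi := hsum i
    rw [hstep i] at hr' hle' hge'
    cases hw : w i with
    | U =>
      simp only [hw, Letter.vec, Prod.snd_add, Prod.fst_add] at hr' hle' hge'
      refine ⟨fun _ => ⟨r', ?_⟩, fun _ => rfl⟩
      have h1 : r = r' + 1 := by omega
      subst h1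
      have := hge (by omega)
      simp only [Nat.add_sub_cancel] at this
      simp only [upPos]
      omega
    | R =>
      simp only [hw, Letter.vec, Prod.snd_add, Prod.fst_add] at hr' hle' hge'
      refine ⟨fun h => by simp at h, ?_⟩
      rintro ⟨s, hs⟩
      exfalso
      have h1 : r' = r := by omega
      subst h1
      rcases lt_or_ge s r' with h | h
      · have h2 : upPos lam (r' - 1) ≤ upPos lam s := hanti.antitone (by omega)
        have := hge' (by omega)
        have h3 : upPos lam (r' - 1) = (lam.getD (r' - 1) 0 : ℤ) - r' := by
          simp only [upPos]; omega
        omega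
      · have h2 : upPos lam s ≤ upPos lam r' := hanti.antitone h
        have h3 : upPos lam r' = (lam.getD r' 0 : ℤ) - (r' + 1) := rfl
        omega
  · rintro ⟨c, hc⟩
    classical
    -- The number of up steps at positions `≥ s`, hence the depth of the path at position `s`.
    let r : ℤ → ℕ := fun s => Nat.find (exists_upPos_lt lam s)
    have hr : ∀ s, upPos lam (r s) < s := fun s => Nat.find_spec (exists_upPos_lt lam s)
    have hmin : ∀ s, 0 < r s → s ≤ upPos lam (r s - 1) := fun s h =>
      not_lt.1 (Nat.find_min (exists_upPos_lt lam s) (Nat.sub_lt h one_pos))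
    have hmono : ∀ s, r (s + 1) ≤ r s := fun s =>
      Nat.find_min' _ ((hr s).trans (lt_add_one s))
    refine ⟨fun i => (i + c + r (i + c), -(r (i + c) : ℤ)), fun i => ?_, fun i => ?_⟩
    · refine ⟨r (i + c), rfl, ?_, fun h => ?_⟩
      · have := hr (i + c)
        simp only [upPos] at this
        simp only
        omega
      · have := hmin (i + c) h
        simp only [upPos] at this
        simp only
        omega
    · have h1 : i + 1 + c = i + c + 1 := by ring
      cases hw : w i with
      | U =>
        obtain ⟨t, ht⟩ := (hc i).1 hw
        have h2 : r (i + c + 1) = t := by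
          refine (Nat.find_eq_iff _).2 ⟨by omega, fun m hm => ?_⟩
          have := hanti hm
          omega
        have h3 : r (i + c) = t + 1 := by
          refine (Nat.find_eq_iff _).2 ⟨?_, fun m hm => ?_⟩
          · have := hanti (Nat.lt_succ_self t)
            simp only [Nat.succ_eq_add_one] at this
            omega
          · have := hanti.antitone (Nat.lt_succ_iff.1 hm)
            omega
        simp only [h1, h2, h3, Letter.vec, Prod.mk_add_mk, Prod.mk.injEq]
        push_cast
        constructor <;> ring
      | R =>
        have h2 : r (i + c + 1) = r (i + c) := by
          refine le_antisymm (hmono _) (Nat.find_min' _ ?_)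
          have h3 := hr (i + c + 1)
          have h4 : upPos lam (r (i + c + 1)) ≠ i + c := fun h => by
            have := (hc i).2 ⟨_, h⟩
            rw [hw] at this
            cases this
          omega
        simp only [h1, h2, Letter.vec, Prod.mk_add_mk, Prod.mk.injEq]
        constructor <;> ring

theorem exists_isCode {lam : List ℕ} (hlam : IsPartition lam) : ∃ w, IsCode lam w := by
  classical
  refine ⟨fun i => if ∃ r, upPos lam r = i then Letter.U else Letter.R,
    (isCode_iff hlam).2 ⟨0, fun i => ?_⟩⟩
  simp

/-- A partition is determined by its length and its code. -/
theorem IsCode.unique {lam nu : List ℕ} (hlam : IsPartition lam) (hnu : IsPartition nu)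
    (hlen : lam.length = nu.length) {w : ℤ → Letter} (hl : IsCode lam w) (hn : IsCode nu w) :
    lam = nu := by
  obtain ⟨c, hc⟩ := (isCode_iff hlam).1 hl
  obtain ⟨d, hd⟩ := (isCode_iff hnu).1 hn
  have h1 : StrictMono fun r => -(upPos lam r - c) := fun r s h => by
    have := hlam.strictAnti_upPos h
    simp only; omega
  have h2 : StrictMono fun r => -(upPos nu r - d) := fun r s h => by
    have := hnu.strictAnti_upPos h
    simp only; omega
  have h3 : (fun r => -(upPos lam r - c)) = fun r => -(upPos nu r - d) := by
    refine (StrictMono.range_inj h1 h2).1 (Set.ext fun i => ?_)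
    have := (hc (-i)).symm.trans (hd (-i))
    simp only [Set.mem_range]
    refine Iff.trans (exists_congr fun r => ?_) (this.trans (exists_congr fun r => ?_)) <;> omega
  have h4 : ∀ r, upPos lam r - c = upPos nu r - d := fun r => neg_injective (congrFun h3 r)
  -- Past the last part both sequences are `-(r + 1)`, which fixes the shift.
  have h5 : c = d := by
    have := h4 lam.length
    rw [upPos_of_length_le le_rfl, upPos_of_length_le hlen.ge] at this
    omega
  refine List.ext_getElem hlen fun r hr hr' => ?_
  have := h4 r
  simp only [upPos, List.getD_eq_getElem _ _ hr, List.getD_eq_getElem _ _ hr'] at this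
  omega

/-! ### Inserting an up step into a code -/

/-- The partition obtained by moving a new part up past the first `r` parts, each of which loses
a box. -/
def insertPart (lam : List ℕ) (r a : ℕ) : List ℕ :=
  (lam.take r).map (· - 1) ++ a :: lam.drop r

theorem getD_insertPart_of_lt {lam : List ℕ} {r a i : ℕ} (hr : r ≤ lam.length) (hi : i < r) :
    (insertPart lam r a).getD i 0 = lam.getD i 0 - 1 := by
  rw [insertPart, List.getD_append _ _ _ _ (by simp; omega),
    List.getD_eq_getElem _ _ (by simp; omega),
    List.getD_eq_getElem _ _ (by omega)]
  simp

theorem getD_insertPart_self {lam : List ℕ} {r a : ℕ} (hr : r ≤ lam.length) :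
    (insertPart lam r a).getD r 0 = a := by
  rw [insertPart, List.getD_append_right _ _ _ _ (by simp)]
  simp [hr]

theorem getD_insertPart_succ {lam : List ℕ} {r a i : ℕ} (hr : r ≤ lam.length) (hi : r ≤ i) :
    (insertPart lam r a).getD (i + 1) 0 = lam.getD i 0 := by
  rw [insertPart, List.getD_append_right _ _ _ _ (by simp; omega)]
  have : i + 1 - min r lam.length = i - r + 1 := by omega
  simp only [List.length_map, List.length_take, this, List.getD_cons_succ]
  simp only [List.getD_eq_getElem?_getD, List.getElem?_drop]
  congr 3
  omega

theorem length_insertPart {lam : List ℕ} {r a : ℕ} (hr : r ≤ lam.length) :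
    (insertPart lam r a).length = lam.length + 1 := by
  simp [insertPart]; omega

/-- The data of inserting an up step at the free position `n` of the code: `r` is the number of
up steps to the right of `n`. -/
structure IsGap (lam : List ℕ) (n : ℤ) (r : ℕ) : Prop where
  le_length : r ≤ lam.length
  lt : upPos lam r < n
  gt : ∀ i < r, n < upPos lam i

theorem exists_isGap {lam : List ℕ} {n : ℤ} (hn : ∀ r, upPos lam r ≠ n) : ∃ r, IsGap lam n r := by
  classical
  have hlen : upPos lam lam.length < n := by
    rw [upPos_of_length_le le_rfl]
    -- Otherwise `n` would be the position of an up step on the negative `y`-axis.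
    by_contra h
    refine hn (-n - 1).toNat ?_
    rw [upPos_of_length_le (by omega)]
    omega
  have hex : ∃ r, upPos lam r < n := ⟨_, hlen⟩
  exact ⟨Nat.find hex, Nat.find_min' hex hlen, Nat.find_spec hex,
    fun i hi => lt_of_le_of_ne (not_lt.1 (Nat.find_min hex hi)) (hn i).symm⟩

namespace IsGap

variable {lam : List ℕ} {n : ℤ} {r : ℕ}

theorem add_nonneg (h : IsGap lam n r) : 0 ≤ n + r := by
  have := h.lt
  simp only [upPos] at this
  omega

/-- The gap inequalities amount to `λ_{r+1} ≤ n + r ≤ λ_r - 1` (the upper bound if `r > 0`), which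
is what the two seams require. -/
theorem isPartition_insertPart (h : IsGap lam n r) (hlam : IsPartition lam) :
    IsPartition (insertPart lam r (n + r).toNat) := by
  refine isPartition_of_antitone_getD (antitone_nat_of_succ_le fun i => ?_)
  have h0 := h.add_nonneg
  have hr := h.le_length
  have hanti : lam.getD (i + 1) 0 ≤ lam.getD i 0 := hlam.antitone_getD (Nat.le_succ i)
  rcases lt_trichotomy i r with hi | rfl | hi
  · rw [getD_insertPart_of_lt hr hi]
    rcases Nat.lt_or_ge (i + 1) r with hi' | hi'
    · rw [getD_insertPart_of_lt hr hi']; omega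
    · have : i + 1 = r := by omega
      rw [this, getD_insertPart_self hr]
      have := h.gt i hi
      simp only [upPos] at this
      omega
  · rw [getD_insertPart_self hr, getD_insertPart_succ hr le_rfl]
    have := h.lt
    simp only [upPos] at this
    omega
  · obtain ⟨i, rfl⟩ : ∃ i', i = i' + 1 := ⟨i - 1, by omega⟩
    rw [getD_insertPart_succ hr (by omega), getD_insertPart_succ hr (by omega)]
    exact hlam.antitone_getD (Nat.le_succ i)

/-- Makes the truncated subtraction in `insertPart` a genuine one. -/
theorem one_le_getD (h : IsGap lam n r) {i : ℕ} (hi : i < r) (hlam : IsPartition lam) :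
    1 ≤ lam.getD i 0 := by
  have h1 := h.gt (r - 1) (by omega)
  have h2 := h.add_nonneg
  have h3 : lam.getD (r - 1) 0 ≤ lam.getD i 0 := hlam.antitone_getD (show i ≤ r - 1 by omega)
  simp only [upPos] at h1
  omega

/-- The first `r` up steps move left by losing a box, the later ones by dropping a row. This uniform
shift is invisible in the code. -/
theorem exists_upPos_insertPart_iff (h : IsGap lam n r) (hlam : IsPartition lam) (s : ℤ) :
    (∃ i, upPos (insertPart lam r (n + r).toNat) i = s - 1) ↔ s = n ∨ ∃ i, upPos lam i = s := by
  have h0 := h.add_nonneg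
  have hr := h.le_length
  have hlt : ∀ i < r, upPos (insertPart lam r (n + r).toNat) i = upPos lam i - 1 := fun i hi => by
    have := h.one_le_getD hi hlam
    simp only [upPos, getD_insertPart_of_lt hr hi]
    omega
  have hself : upPos (insertPart lam r (n + r).toNat) r = n - 1 := by
    simp only [upPos, getD_insertPart_self hr]
    omega
  have hsucc : ∀ i, r ≤ i →
      upPos (insertPart lam r (n + r).toNat) (i + 1) = upPos lam i - 1 := fun i hi => by
    simp only [upPos, getD_insertPart_succ hr hi]
    omega
  constructor
  · rintro ⟨i, hi⟩
    rcases lt_trichotomy i r with hir | rfl | hir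
    · exact Or.inr ⟨i, by rw [hlt i hir] at hi; omega⟩
    · exact Or.inl (by omega)
    · obtain ⟨i, rfl⟩ : ∃ i', i = i' + 1 := ⟨i - 1, by omega⟩
      exact Or.inr ⟨i, by rw [hsucc i (by omega)] at hi; omega⟩
  · rintro (rfl | ⟨i, rfl⟩)
    · exact ⟨r, hself⟩
    · rcases lt_or_ge i r with hir | hir
      · exact ⟨i, hlt i hir⟩
      · exact ⟨i + 1, hsucc i hir⟩

theorem isCode_insertPart (h : IsGap lam n r) (hlam : IsPartition lam) {w : ℤ → Letter} {c q : ℤ}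
    (hc : ∀ i, w i = Letter.U ↔ ∃ r, upPos lam r = i + c) (hq : q + c = n) :
    IsCode (insertPart lam r (n + r).toNat) (Function.update w q Letter.U) := by
  refine (isCode_iff (h.isPartition_insertPart hlam)).2 ⟨c - 1, fun i => ?_⟩
  rw [← add_sub_assoc, h.exists_upPos_insertPart_iff hlam, ← hc i, Function.update_apply]
  split_ifs with hi
  · subst hi; simp [hq]
  · have : i + c ≠ n := by omega
    simp [this]

/-- Of the `r` up steps right of `n`, the rightmost one is excluded from the open interval; hence
the `+ 1`, which becomes the exponent `j + 1`. -/
theorem card_filter_U (h : IsGap lam n r) (hlam : IsPartition lam) {w : ℤ → Letter} {c p q : ℤ}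
    (hc : ∀ i, w i = Letter.U ↔ ∃ r, upPos lam r = i + c) (hq : q + c = n)
    (hp : p + c = upPos lam 0) (hqp : q < p) :
    ((Finset.Ioo q p).filter fun i => w i = Letter.U).card + 1 = r := by
  have hanti := hlam.strictAnti_upPos
  have hr : 0 < r := by
    rcases Nat.eq_zero_or_pos r with rfl | hr
    · have := h.lt; omega
    · exact hr
  have : ((Finset.Ioo q p).filter fun i => w i = Letter.U) =
      (Finset.Ico 1 r).image fun i => upPos lam i - c := by
    ext i
    simp only [Finset.mem_filter, Finset.mem_Ioo, Finset.mem_image, Finset.mem_Ico, hc]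
    constructor
    · rintro ⟨⟨h1, h2⟩, s, hs⟩
      refine ⟨s, ⟨hanti.lt_iff_gt.1 (by omega), ?_⟩, by omega⟩
      by_contra hsr
      have := hanti.antitone (not_lt.1 hsr)
      have := h.lt
      omega
    · rintro ⟨s, ⟨h1, h2⟩, rfl⟩
      have := h.gt s h2
      have := hanti (show 0 < s by omega)
      exact ⟨⟨by omega, by omega⟩, s, by omega⟩
  rw [this, Finset.card_image_of_injective _ fun a b hab => hanti.injective (by simpa using hab)]
  simp
  omega

end IsGap

/-! ## Products of Bernstein operators along codes -/

theorem bernsteinPart_eq (lam : List ℕ) :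
    bernsteinPart lam = bernsteinProd (lam.map (Nat.cast : ℕ → ℤ)) := by
  simp [bernsteinPart, List.map_eq_flatMap]

theorem bernsteinPart_append (xs ys : List ℕ) :
    bernsteinPart (xs ++ ys) = bernsteinPart xs * bernsteinPart ys := by
  simp [bernsteinPart_eq, bernsteinProd]

theorem bernsteinPart_cons (x : ℕ) (ys : List ℕ) :
    bernsteinPart (x :: ys) = bernstein x * bernsteinPart ys := by
  simp [bernsteinPart_eq, bernsteinProd]

/-- After passing `r` factors the operator is `B_{n+r}`, and the next part is `n + r + 1`. -/
theorem bernstein_mul_bernsteinPart_eq_zero {lam : List ℕ} {n : ℤ} {r : ℕ} (hr : r < lam.length)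
    (h : upPos lam r = n) : bernstein n * bernsteinPart lam = 0 := by
  have hs : lam = lam.take r ++ lam[r] :: lam.drop (r + 1) := by
    rw [List.getElem_cons_drop, List.take_append_drop]
  have hr' : (lam[r] : ℤ) = n + r + 1 := by
    rw [upPos, List.getD_eq_getElem _ _ hr] at h
    omega
  rw [hs, bernsteinPart_append, bernsteinPart_cons, ← mul_assoc, bernsteinPart_eq,
    bernstein_mul_bernsteinProd, smul_mul_assoc, mul_assoc, ← mul_assoc (bernstein (n + _)), hr']
  have hl : ((List.map (Nat.cast : ℕ → ℤ) (lam.take r)).length : ℤ) = r := by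
    rw [List.length_map, List.length_take, min_eq_left hr.le]
  rw [hl, bernstein_mul_bernstein_succ, zero_mul, mul_zero, smul_zero]

theorem bernstein_bernsteinPart_one {lam : List ℕ} {n : ℤ} (h : n < -(lam.length : ℤ)) :
    bernstein n (bernsteinPart lam 1) = 0 := by
  rw [← Module.End.mul_apply, bernsteinPart_eq, bernstein_mul_bernsteinProd, LinearMap.smul_apply,
    Module.End.mul_apply, bernstein_one_of_neg (by rw [List.length_map]; omega), map_zero,
    smul_zero]

theorem IsGap.bernstein_mul_bernsteinPart {lam : List ℕ} {n : ℤ} {r : ℕ} (h : IsGap lam n r)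
    (hlam : IsPartition lam) : bernstein n * bernsteinPart lam =
      (-1 : ℂ) ^ r • bernsteinPart (insertPart lam r (n + r).toNat) := by
  have hr := h.le_length
  have hl : ((List.map (Nat.cast : ℕ → ℤ) (lam.take r)).length) = r := by
    rw [List.length_map, List.length_take, min_eq_left hr]
  have hm : ((lam.take r).map (Nat.cast : ℕ → ℤ)).map (· - 1) =
      ((lam.take r).map (· - 1)).map (Nat.cast : ℕ → ℤ) := by
    rw [List.map_map, List.map_map]
    refine List.map_congr_left fun a ha => ?_
    obtain ⟨i, hi, rfl⟩ := List.mem_iff_getElem.1 ha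
    rw [List.length_take] at hi
    have := h.one_le_getD (i := i) (by omega) hlam
    rw [List.getD_eq_getElem _ _ (by omega)] at this
    simp only [Function.comp_apply, List.getElem_take]
    omega
  rw [insertPart, bernsteinPart_append, bernsteinPart_cons, Int.toNat_of_nonneg h.add_nonneg]
  conv_lhs => rw [← List.take_append_drop r lam, bernsteinPart_append]
  rw [← mul_assoc, bernsteinPart_eq, bernstein_mul_bernsteinProd, hl, hm, smul_mul_assoc, mul_assoc,
    bernsteinPart_eq (lam.drop r), bernsteinPart_eq]

end BernsteinCode

end

theorem corollary4p3
    (lam : List ℕ) (hlam : BernsteinCode.IsPartition lam) (hne : lam ≠ [])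
    (n k : ℤ) (hn : n < (lam.head hne : ℤ)) (hk : k = (lam.head hne : ℤ) - n) :
    (∃ w : ℤ → BernsteinCode.Letter, BernsteinCode.IsCode lam w) ∧
    ∀ w : ℤ → BernsteinCode.Letter, BernsteinCode.IsCode lam w →
      -- `w` has a rightmost `U`, in position `p`; the letter `ζ` is in position `q`
      ∃ p : ℤ, w p = BernsteinCode.Letter.U ∧ (∀ i, p < i → w i = BernsteinCode.Letter.R) ∧
      ∀ q : ℤ, q = p - (k - 1) →
        (w q = BernsteinCode.Letter.U →
          BernsteinCode.bernstein n (BernsteinCode.bernsteinPart lam 1) = 0 ∧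
          (-(lam.length : ℤ) ≤ n →
            BernsteinCode.bernstein n * BernsteinCode.bernsteinPart lam = 0)) ∧
        (w q = BernsteinCode.Letter.R →
          (∃ nu : List ℕ, BernsteinCode.IsPartition nu ∧ nu.length = lam.length + 1 ∧
            BernsteinCode.IsCode nu (Function.update w q BernsteinCode.Letter.U)) ∧
          ∀ nu : List ℕ, BernsteinCode.IsPartition nu → nu.length = lam.length + 1 →
            BernsteinCode.IsCode nu (Function.update w q BernsteinCode.Letter.U) →
            ∀ j : ℕ, j = ((Finset.Ioo q p).filter fun i => w i = BernsteinCode.Letter.U).card →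
              BernsteinCode.bernstein n * BernsteinCode.bernsteinPart lam =
                (-1 : ℂ) ^ (j + 1) • BernsteinCode.bernsteinPart nu) := by
  open BernsteinCode in
  refine ⟨exists_isCode hlam, fun w hw => ?_⟩
  obtain ⟨c, hc⟩ := (isCode_iff hlam).1 hw
  have hanti := hlam.strictAnti_upPos
  have h0 : upPos lam 0 = (lam.head hne : ℤ) - 1 := by
    cases lam with
    | nil => exact absurd rfl hne
    | cons a l => simp [upPos]
  have hp : upPos lam 0 - c + c = upPos lam 0 := sub_add_cancel _ _
  refine ⟨upPos lam 0 - c, (hc _).2 ⟨0, hp.symm⟩, fun i hi => ?_, ?_⟩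
  · cases hwi : w i with
    | R => rfl
    | U =>
      obtain ⟨r, hr⟩ := (hc i).1 hwi
      have := hanti.antitone (Nat.zero_le r)
      omega
  rintro q hq
  -- In normalised position, `ζ` is at `(λ_1 - 1) - (k - 1) = n`.
  have hqn : q + c = n := by omega
  refine ⟨fun hU => ?_, fun hR => ?_⟩
  · obtain ⟨r, hr⟩ := (hc q).1 hU
    rw [hqn] at hr
    rcases lt_or_ge r lam.length with hrl | hrl
    · have hz := bernstein_mul_bernsteinPart_eq_zero hrl hr
      exact ⟨by rw [← Module.End.mul_apply, hz, LinearMap.zero_apply], fun _ => hz⟩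
    -- Here `n = -(r + 1) < -l`, so only the vanishing on `1` remains to be shown.
    · rw [upPos_of_length_le hrl] at hr
      exact ⟨bernstein_bernsteinPart_one (by omega), fun h => by omega⟩
  · have hfree : ∀ r, upPos lam r ≠ n := fun r hr => by
      have := (hc q).2 ⟨r, by omega⟩
      rw [hR] at this
      cases this
    obtain ⟨r, hgap⟩ := exists_isGap hfree
    have hcode := hgap.isCode_insertPart hlam hc hqn
    have hpart := hgap.isPartition_insertPart hlam
    have hlen := length_insertPart (a := (n + r).toNat) hgap.le_length
    refine ⟨⟨_, hpart, hlen, hcode⟩, fun nu hnu hnulen hnucode j hj => ?_⟩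
    rw [hnucode.unique hnu hpart (hnulen.trans hlen.symm) hcode, hj,
      hgap.card_filter_U hlam hc hqn hp (by have := hfree 0; omega),
      hgap.bernstein_mul_bernsteinPart hlam]
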